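/- Let $n\ge 1$, $d\ge 2$. In the random-oracle one-way-marginals problem $\mathcal P_{RO}$ there is an underlying dataset $D=(x_1,\dots,x_n)$ with $x_i\in\{0,1\}^d$ and a uniformly random oracle $H:[n]\to\{0,1\}^d$. An algorithm is given the encoded dataset $(z_1,\dots,z_n)$, $z_i=H(i)\oplus x_i$, and may use random coins (independent of $H$) and adaptive row queries to $H$ (a row query $i\in[n]$ is answered by $H(i)\in\{0,1\}^d$ and counts as $d$ attribute queries). It outputs a vector $a\in\mathbb R^d$. It has attribute query complexity $s$ if it never makes more than $s$ attribute queries. It is $(\alpha,p)$-accurate if for every $D$, with probability at least $1-p$, $\left|a_j-\frac1n\sum_{i=1}^n x_{i,j}\right|\le\alpha$ for all $j\in[d]$. It is $(\varepsilon,\delta)$-DP if $\Pr[a(D)\in S]\le e^{\varepsilon}\Pr[a(D')\in S]+\delta$ for all datasets $D,D'$ that differ in one row and all measurable $S\subseteq\mathbb R^d$. All probabilities are over the coins and $H$. **Theorem.** In the regime $n=O(d)$ (which includes the case $n=\Theta(\sqrt d)$), any algorithm for $\mathcal P_{RO}$ with attribute query complexity $s$ that is $(1/3,1/3)$-accurate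 and $(O(1),o(1/s))$-DP must have $s=\Omega\big(d\sqrt{d/\log d}\big)$. Explicitly: for all real $\varepsilon_0$ and $K$ there are constants $\eta,c>0$ such that for all integers $n\ge1$, $d\ge2$ with $n\le Kd$, all integers $s\ge0$ and all real $\varepsilon\le\varepsilon_0$, $\delta$ with $\delta s\le\eta$: every algorithm for $\mathcal P_{RO}$ with attribute query complexity $s$ that is $(1/3,1/3)$-accurate and $(\varepsilon,\delta)$-DP satisfies $s\ge c\,d\sqrt{d/\log d}$. -/

import Mathlib

open MeasureTheory

universe u

namespace RandomOracleMarginals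

/-- A dataset of `n` rows with `d` binary attributes each. -/
abbrev Dataset (n d : ℕ) : Type := Fin n → Fin d → Bool

/-- Two datasets of the same size are neighbouring if they differ in (at most) one row. -/
def Neighboring {n d : ℕ} (D D' : Dataset n d) : Prop :=
  ∃ i : Fin n, ∀ k : Fin n, k ≠ i → D k = D' k

/-- The `j`-th one-way marginal: the average of the `j`-th column. -/
noncomputable def oneWayMarginal {n d : ℕ} (D : Dataset n d) (j : Fin d) : ℝ :=
  (∑ i : Fin n, if D i j then (1 : ℝ) else 0) / n

/-- The one-time-pad encoding `z_i = H(i) ⊕ x_i` of the dataset `D` under the oracle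
`H : [n] → {0,1}^d`. -/
def encode {n d : ℕ} (H D : Dataset n d) : Dataset n d :=
  fun i j => xor (H i j) (D i j)

/-- A deterministic adaptive procedure with row-query access to an oracle
`H : [n] → {0,1}^d`: either stop and output a vector, or query a row index `i` and continue
depending on the answer `H(i)`. -/
inductive QueryTree (n d : ℕ) : Type
  | output (a : Fin d → ℝ) : QueryTree n d
  | query (i : Fin n) (next : (Fin d → Bool) → QueryTree n d) : QueryTree n d

namespace QueryTree

/-- The vector output when the queries are answered by `H`. -/
def eval {n d : ℕ} : QueryTree n d → Dataset n d → (Fin d → ℝ)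
  | output a, _ => a
  | query i next, H => (next (H i)).eval H

/-- The number of row queries made when the queries are answered by `H`. -/
def rowQueries {n d : ℕ} : QueryTree n d → Dataset n d → ℕ
  | output _, _ => 0
  | query i next, H => (next (H i)).rowQueries H + 1

end QueryTree

/-- A randomized algorithm for the random-oracle problem: it tosses coins from an arbitrary
probability space, receives the whole encoded dataset `z`, and then makes adaptive row queries
to the oracle. The output has to be a random variable. -/
structure Algorithm (n d : ℕ) where
  /-- the space of coin tosses -/
  Coins : Type u
  [measurableSpace : MeasurableSpace Coins]
  /-- the law of the coin tosses -/
  law : Measure Coins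
  [isProbabilityMeasure : IsProbabilityMeasure law]
  /-- the procedure run with given coins on a given encoded dataset -/
  run : Coins → Dataset n d → QueryTree n d
  measurable_eval : ∀ z H : Dataset n d, Measurable fun ω => (run ω z).eval H

attribute [instance] Algorithm.measurableSpace Algorithm.isProbabilityMeasure

namespace Algorithm

variable {n d : ℕ}

/-- The output when the underlying dataset is `D`, as a function of the coins and the oracle:
the algorithm is run on `encode H D` with oracle access to `H`. -/
def result (A : Algorithm.{u} n d) (D : Dataset n d) (x : A.Coins × Dataset n d) :
    Fin d → ℝ :=
  (A.run x.1 (encode x.2 D)).eval x.2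

/-- The law of the output on the underlying dataset `D`, over the coins of the algorithm and
an independent uniformly random oracle `H`. -/
noncomputable def outputLaw (A : Algorithm.{u} n d) (D : Dataset n d) :
    Measure (Fin d → ℝ) :=
  (A.law.prod (PMF.uniformOfFintype (Dataset n d)).toMeasure).map (A.result D)

theorem measurable_result (A : Algorithm.{u} n d) (D : Dataset n d) :
    Measurable (A.result D) :=
  measurable_from_prod_countable_left fun H => A.measurable_eval (encode H D) H

instance (A : Algorithm.{u} n d) (D : Dataset n d) :
    IsProbabilityMeasure (A.outputLaw D) :=
  Measure.isProbabilityMeasure_map (A.measurable_result D).aemeasurable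

/-- The algorithm never makes more than `s` attribute queries, where one row query counts as
`d` attribute queries. -/
def AttributeQueriesLE (A : Algorithm.{u} n d) (s : ℕ) : Prop :=
  ∀ (ω : A.Coins) (z H : Dataset n d), (A.run ω z).rowQueries H * d ≤ s

/-- `(α, p)`-accuracy: on every underlying dataset, with probability at least `1 - p`, all the
one-way marginals are released up to an additive error `α`. -/
def Accurate (A : Algorithm.{u} n d) (α p : ℝ) : Prop :=
  ∀ D : Dataset n d,
    1 - p ≤ (A.outputLaw D).real {a | ∀ j, |oneWayMarginal D j - a j| ≤ α}

/-- `(ε, δ)`-differential privacy with respect to the underlying dataset. -/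
def DifferentiallyPrivate (A : Algorithm.{u} n d) (ε δ : ℝ) : Prop :=
  ∀ D D' : Dataset n d, Neighboring D D' → ∀ S : Set (Fin d → ℝ), MeasurableSet S →
    (A.outputLaw D).real S ≤ Real.exp ε * (A.outputLaw D').real S + δ

end Algorithm

end RandomOracleMarginals

/-! The argument is a fingerprinting lower bound in which the one-time pad limits how many rows can
be fingerprinted. Draw the rows of `D` independently with Bernoulli column means `p`, round the
answers to signs, and give row `i` the score `rowScore`: the correlation of the signs with the
logarithmic derivative of its likelihood. A row independent of the output has mean score zero.

Lower bound (`le_of_sum_rowScore_le`): the expected total score is the divergence in `p` of the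
expected sign vector. Accuracy pushes that vector outward through the faces of the box of means, so
by the divergence theorem some `p` in the box has expected total score at least `d / 3`.

Upper bound (`sum_rowScore_le`): fix the coins and the encoded data `z`. Then `H = encode z D`, so
the output depends on `D` only through the queried rows, and unqueried rows contribute zero on
average. Each of the at most `q` queried rows contributes at most `τ`, unless its score exceeds `τ`.
By privacy this happens to a given row with probability at most `exp ε` times the Chernoff tail of a
fresh row, plus `δ` (`DifferentiallyPrivate.sum_tail_le`).

With `τ` of order `√(d log d)` the tail is `1 / d ^ 2`, so for `n = O(d)` and `δ` small against `1 /
s` the exceptional rows cost at most `d / 6 + O(1)`. Hence `q √(d log d)` is at least of order `d`,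
and `s ≥ q d`. -/

namespace RandomOracleMarginals

/-! ### Product distributions on datasets -/

section Resampling

variable {ι R : Type*} [Fintype ι] [DecidableEq ι]

theorem sum_prod_mul_apply [Fintype R] (w : ι → R → ℝ) (hw : ∀ k, ∑ b, w k b = 1) (j : ι) (f : R → ℝ) :
    ∑ r : ι → R, (∏ k, w k (r k)) * f (r j) = ∑ b, w j b * f b := by
  have h : ∀ r : ι → R, (∏ k, w k (r k)) * f (r j)
      = ∏ k, (w k (r k) * if k = j then f (r k) else 1) := by
    intro r
    rw [Finset.prod_mul_distrib]
    simp
  simp_rw [h]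
  rw [← Fintype.prod_sum (fun k b => w k b * if k = j then f b else 1),
    Finset.prod_eq_single j]
  · simp
  · intro k _ hk
    simp [hk, hw]
  · simp

/-- Exchanging coordinate `i` with an independent copy `r` preserves the joint weight; this is what
makes resampling valid. -/
theorem prod_update_mul (w : R → ℝ) (D : ι → R) (i : ι) (r : R) :
    (∏ k, w (Function.update D i r k)) * w (D i) = (∏ k, w (D k)) * w r := by
  rw [← Finset.mul_prod_erase _ _ (Finset.mem_univ i),
    ← Finset.mul_prod_erase Finset.univ (fun k => w (D k)) (Finset.mem_univ i)]
  have : ∏ k ∈ Finset.univ.erase i, w (Function.update D i r k)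
      = ∏ k ∈ Finset.univ.erase i, w (D k) :=
    Finset.prod_congr rfl fun k hk => by
      rw [Function.update_of_ne (Finset.ne_of_mem_erase hk)]
  rw [this, Function.update_self]
  ring

/-- In a product distribution, coordinate `i` may be resampled independently of the others. -/
theorem sum_prod_mul_resample [Fintype R] (w : R → ℝ) (hw : ∑ b, w b = 1) (i : ι) (r₀ : R)
    (F : (ι → R) → R → ℝ) :
    ∑ D : ι → R, (∏ k, w (D k)) * F (Function.update D i r₀) (D i)
      = ∑ D : ι → R, (∏ k, w (D k)) * ∑ r, w r * F (Function.update D i r₀) r := by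
  have h1 : ∀ D : ι → R, (∏ k, w (D k)) * F (Function.update D i r₀) (D i)
      = ∑ r, (∏ k, w (D k)) * w r * F (Function.update D i r₀) (D i) := by
    intro D
    rw [← Finset.sum_mul, ← Finset.mul_sum, hw, mul_one]
  simp_rw [h1, Finset.mul_sum]
  rw [← Fintype.sum_prod_type', ← Fintype.sum_prod_type']
  -- The exchange of `D i` with `r` is an involution, hence its own inverse here.
  refine Finset.sum_nbij' (fun x => (Function.update x.1 i x.2, x.1 i))
    (fun x => (Function.update x.1 i x.2, x.1 i)) (by simp) (by simp) (by simp) (by simp) ?_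
  rintro ⟨D, r⟩ -
  simp only [Function.update_idem, ← mul_assoc, prod_update_mul]

end Resampling

/-- The probability of the bit `b` under the Bernoulli distribution with mean `t`. -/
noncomputable def bitWeight (t : ℝ) (b : Bool) : ℝ := if b then t else 1 - t

/-- The logarithmic derivative of `bitWeight t b` in `t`. -/
noncomputable def bitScore (t : ℝ) (b : Bool) : ℝ := if b then 1 / t else -(1 / (1 - t))

/-- The distribution of a row with independent Bernoulli bits. -/
noncomputable def rowWeight {d : ℕ} (p : Fin d → ℝ) (r : Fin d → Bool) : ℝ :=
  ∏ j, bitWeight (p j) (r j)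

/-- The distribution of a dataset with independent rows drawn from `rowWeight p`. -/
noncomputable def datasetWeight {n d : ℕ} (p : Fin d → ℝ) (D : Dataset n d) : ℝ :=
  ∏ i, rowWeight p (D i)

variable {n d : ℕ}

theorem sum_bitWeight (t : ℝ) : ∑ b, bitWeight t b = 1 := by simp [bitWeight]

theorem bitWeight_nonneg {t : ℝ} (h0 : 0 ≤ t) (h1 : t ≤ 1) (b : Bool) : 0 ≤ bitWeight t b := by
  unfold bitWeight; split_ifs <;> linarith

theorem rowWeight_nonneg {p : Fin d → ℝ} (h0 : ∀ j, 0 ≤ p j) (h1 : ∀ j, p j ≤ 1)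
    (r : Fin d → Bool) : 0 ≤ rowWeight p r :=
  Finset.prod_nonneg fun j _ => bitWeight_nonneg (h0 j) (h1 j) _

theorem datasetWeight_nonneg {p : Fin d → ℝ} (h0 : ∀ j, 0 ≤ p j) (h1 : ∀ j, p j ≤ 1)
    (D : Dataset n d) : 0 ≤ datasetWeight p D :=
  Finset.prod_nonneg fun _ _ => rowWeight_nonneg h0 h1 _

theorem sum_rowWeight (p : Fin d → ℝ) : ∑ r, rowWeight p r = 1 := by
  unfold rowWeight
  rw [← Fintype.prod_sum (fun j b => bitWeight (p j) b)]
  simp only [sum_bitWeight, Finset.prod_const_one]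

theorem sum_datasetWeight (p : Fin d → ℝ) : ∑ D : Dataset n d, datasetWeight p D = 1 := by
  unfold datasetWeight
  rw [← Fintype.prod_sum (fun _ r => rowWeight p r)]
  simp only [sum_rowWeight, Finset.prod_const_one]

theorem sum_rowWeight_mul_apply (p : Fin d → ℝ) (j : Fin d) (f : Bool → ℝ) :
    ∑ r, rowWeight p r * f (r j) = ∑ b, bitWeight (p j) b * f b :=
  sum_prod_mul_apply (fun j => bitWeight (p j)) (fun _ => sum_bitWeight _) j f

theorem sum_datasetWeight_mul_apply (p : Fin d → ℝ) (i : Fin n) (f : (Fin d → Bool) → ℝ) :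
    ∑ D : Dataset n d, datasetWeight p D * f (D i) = ∑ r, rowWeight p r * f r :=
  sum_prod_mul_apply (fun _ => rowWeight p) (fun _ => sum_rowWeight _) i f

theorem sum_datasetWeight_mul_resample (p : Fin d → ℝ) (i : Fin n) (r₀ : Fin d → Bool)
    (F : Dataset n d → (Fin d → Bool) → ℝ) :
    ∑ D : Dataset n d, datasetWeight p D * F (Function.update D i r₀) (D i)
      = ∑ D : Dataset n d, datasetWeight p D *
          ∑ r, rowWeight p r * F (Function.update D i r₀) r :=
  sum_prod_mul_resample (rowWeight p) (sum_rowWeight p) i r₀ F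

theorem sum_datasetWeight_mul_oneWayMarginal (hn : 1 ≤ n) (p : Fin d → ℝ) (j : Fin d) :
    ∑ D : Dataset n d, datasetWeight p D * oneWayMarginal D j = p j := by
  have hn' : (n : ℝ) ≠ 0 := by positivity
  have h : ∀ i : Fin n, ∑ D : Dataset n d, datasetWeight p D * (if D i j then (1 : ℝ) else 0)
      = p j := by
    intro i
    rw [sum_datasetWeight_mul_apply p i (fun r => if r j then (1 : ℝ) else 0),
      sum_rowWeight_mul_apply p j (fun b => if b then (1 : ℝ) else 0)]
    simp [bitWeight]
  simp only [oneWayMarginal, mul_div_assoc', Finset.mul_sum]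
  rw [← Finset.sum_div, Finset.sum_comm]
  simp only [h]
  simp
  field_simp

/-! ### Scores: mean zero, worst-case size and Chernoff bound -/

theorem bitWeight_mul_bitScore {t : ℝ} (h0 : t ≠ 0) (h1 : t ≠ 1) (b : Bool) :
    bitWeight t b * bitScore t b = if b then 1 else -1 := by
  have : 1 - t ≠ 0 := sub_ne_zero.2 h1.symm
  unfold bitWeight bitScore
  split_ifs <;> field_simp

theorem sum_bitWeight_mul_bitScore {t : ℝ} (h0 : t ≠ 0) (h1 : t ≠ 1) :
    ∑ b, bitWeight t b * bitScore t b = 0 := by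
  simp [bitWeight_mul_bitScore h0 h1]

theorem abs_bitScore_le {t γ : ℝ} (hγ : 0 < γ) (h0 : γ ≤ t) (h1 : t ≤ 1 - γ) (b : Bool) :
    |bitScore t b| ≤ 1 / γ := by
  unfold bitScore
  split_ifs
  · rw [abs_of_pos (by have := hγ.trans_le h0; positivity)]
    exact one_div_le_one_div_of_le hγ h0
  · rw [abs_neg, abs_of_pos (one_div_pos.2 (by linarith))]
    exact one_div_le_one_div_of_le hγ (by linarith)

/-- The score of the row `r` against the signs `b`: the correlation that `b` shows with `r`. -/
noncomputable def rowScore (p : Fin d → ℝ) (b : Fin d → ℝ) (r : Fin d → Bool) : ℝ :=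
  ∑ j, b j * bitScore (p j) (r j)

section Score

variable {p : Fin d → ℝ} {γ : ℝ}

theorem sum_rowWeight_mul_rowScore (h0 : ∀ j, p j ≠ 0) (h1 : ∀ j, p j ≠ 1) (b : Fin d → ℝ) :
    ∑ r, rowWeight p r * rowScore p b r = 0 := by
  simp only [rowScore, Finset.mul_sum]
  rw [Finset.sum_comm]
  refine Finset.sum_eq_zero fun j _ => ?_
  rw [sum_rowWeight_mul_apply p j (fun x => b j * bitScore (p j) x)]
  simp only [mul_left_comm _ (b j), ← Finset.mul_sum, sum_bitWeight_mul_bitScore (h0 j) (h1 j),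
    mul_zero]

theorem abs_rowScore_le (hγ : 0 < γ) (h0 : ∀ j, γ ≤ p j) (h1 : ∀ j, p j ≤ 1 - γ)
    {b : Fin d → ℝ} (hb : ∀ j, |b j| ≤ 1) (r : Fin d → Bool) :
    |rowScore p b r| ≤ d / γ := by
  have h : ∀ j ∈ (Finset.univ : Finset (Fin d)), |b j * bitScore (p j) (r j)| ≤ 1 / γ := by
    intro j _
    rw [abs_mul]
    calc |b j| * |bitScore (p j) (r j)| ≤ 1 * (1 / γ) :=
          mul_le_mul (hb j) (abs_bitScore_le hγ (h0 j) (h1 j) _) (abs_nonneg _) zero_le_one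
      _ = 1 / γ := one_mul _
  refine (Finset.abs_sum_le_sum_abs _ _).trans ((Finset.sum_le_sum h).trans_eq ?_)
  simp [div_eq_mul_inv]

/-- The condition `|c| ≤ γ` keeps the exponent in `[-1, 1]`, where `exp x ≤ 1 + x + x ^ 2`; the
linear term vanishes because the score has mean zero. -/
theorem sum_bitWeight_mul_exp_le (hγ : 0 < γ) {t : ℝ} (h0 : γ ≤ t) (h1 : t ≤ 1 - γ)
    {c : ℝ} (hc : |c| ≤ γ) :
    ∑ x, bitWeight t x * Real.exp (c * bitScore t x) ≤ Real.exp ((c / γ) ^ 2) := by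
  have hx : ∀ x, |c * bitScore t x| ≤ |c| / γ := fun x => by
    rw [abs_mul, div_eq_mul_one_div]
    exact mul_le_mul_of_nonneg_left (abs_bitScore_le hγ h0 h1 x) (abs_nonneg c)
  have he : ∀ x, Real.exp (c * bitScore t x) ≤ 1 + c * bitScore t x + (c / γ) ^ 2 := fun x => by
    have h2 := (le_abs_self _).trans
      (Real.abs_exp_sub_one_sub_id_le ((hx x).trans ((div_le_one hγ).2 hc)))
    have h3 : (c * bitScore t x) ^ 2 ≤ (c / γ) ^ 2 := by
      refine sq_le_sq.2 ((hx x).trans_eq ?_)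
      rw [abs_div, abs_of_pos hγ]
    linarith
  calc ∑ x, bitWeight t x * Real.exp (c * bitScore t x)
      ≤ ∑ x, bitWeight t x * (1 + c * bitScore t x + (c / γ) ^ 2) :=
        Finset.sum_le_sum fun x _ => mul_le_mul_of_nonneg_left (he x)
          (bitWeight_nonneg (by linarith) (by linarith) x)
    _ = (1 + (c / γ) ^ 2) * ∑ x, bitWeight t x + c * ∑ x, bitWeight t x * bitScore t x := by
        rw [Finset.mul_sum, Finset.mul_sum, ← Finset.sum_add_distrib]
        exact Finset.sum_congr rfl fun x _ => by ring
    _ = (c / γ) ^ 2 + 1 := by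
        rw [sum_bitWeight, sum_bitWeight_mul_bitScore (by linarith) (by linarith)]; ring
    _ ≤ _ := Real.add_one_le_exp _

/-- Chernoff bound for the score of a fresh row against fixed signs. -/
theorem sum_rowWeight_rowScore_gt_le (hγ : 0 < γ) (h0 : ∀ j, γ ≤ p j) (h1 : ∀ j, p j ≤ 1 - γ)
    {b : Fin d → ℝ} (hb : ∀ j, |b j| ≤ 1) {l : ℝ} (hl0 : 0 ≤ l) (hl1 : l ≤ γ) (τ : ℝ) :
    ∑ r, rowWeight p r * (if τ < rowScore p b r then 1 else 0)
      ≤ Real.exp (d * (l / γ) ^ 2 - l * τ) := by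
  have hw : ∀ r, 0 ≤ rowWeight p r :=
    rowWeight_nonneg (fun j => hγ.le.trans (h0 j)) (fun j => (h1 j).trans (by linarith))
  have hprod : ∀ r, rowWeight p r * Real.exp (l * rowScore p b r)
      = ∏ j, (bitWeight (p j) (r j) * Real.exp (l * b j * bitScore (p j) (r j))) := fun r => by
    rw [Finset.prod_mul_distrib, ← Real.exp_sum, rowScore, Finset.mul_sum, rowWeight]
    simp only [mul_assoc]
  calc ∑ r, rowWeight p r * (if τ < rowScore p b r then 1 else 0)
      ≤ ∑ r, rowWeight p r * Real.exp (l * rowScore p b r) * Real.exp (-(l * τ)) := by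
        refine Finset.sum_le_sum fun r _ => ?_
        rw [mul_assoc, ← Real.exp_add]
        refine mul_le_mul_of_nonneg_left ?_ (hw r)
        split_ifs with h
        · exact Real.one_le_exp (by nlinarith)
        · exact (Real.exp_pos _).le
    _ = (∏ j, ∑ x, bitWeight (p j) x * Real.exp (l * b j * bitScore (p j) x))
          * Real.exp (-(l * τ)) := by
        rw [← Finset.sum_mul, Fintype.prod_sum]
        simp only [hprod]
    _ ≤ (∏ _j : Fin d, Real.exp ((l / γ) ^ 2)) * Real.exp (-(l * τ)) := by
        refine mul_le_mul_of_nonneg_right (Finset.prod_le_prod (fun j _ => ?_) fun j _ => ?_)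
          (Real.exp_pos _).le
        · exact Finset.sum_nonneg fun x _ => mul_nonneg
            (bitWeight_nonneg (hγ.le.trans (h0 j)) ((h1 j).trans (by linarith)) x)
            (Real.exp_pos _).le
        · have habs : |l * b j| ≤ l := by
            rw [abs_mul, abs_of_nonneg hl0]
            exact mul_le_of_le_one_right hl0 (hb j)
          refine (sum_bitWeight_mul_exp_le hγ (h0 j) (h1 j) (habs.trans hl1)).trans
            (Real.exp_le_exp.2 (sq_le_sq.2 ?_))
          rw [abs_div, abs_div, abs_of_nonneg hl0]
          exact div_le_div_of_nonneg_right habs (abs_nonneg γ)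
    _ = Real.exp (d * (l / γ) ^ 2 - l * τ) := by
        rw [Finset.prod_const, ← Real.exp_nat_mul, ← Real.exp_add, Finset.card_univ,
          Fintype.card_fin, sub_eq_add_neg]

end Score

/-! ### Rows that are not queried carry no score -/

namespace QueryTree

/-- The set of rows queried when the queries are answered by `H`. -/
def queriedRows : QueryTree n d → Dataset n d → Finset (Fin n)
  | output _, _ => ∅
  | query i next, H => insert i ((next (H i)).queriedRows H)

theorem card_queriedRows_le (T : QueryTree n d) (H : Dataset n d) :
    (T.queriedRows H).card ≤ T.rowQueries H := by
  induction T with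
  | output a => simp [queriedRows]
  | query i next ih =>
    exact (Finset.card_insert_le _ _).trans (Nat.succ_le_succ (ih (H i)))

/-- The path through the tree is determined by the answers met along it. In particular, whether row
`i` is queried, and the output if it is not, are independent of the content of row `i`. -/
theorem queriedRows_eval_congr (T : QueryTree n d) {H H' : Dataset n d}
    (h : ∀ i ∈ T.queriedRows H, H i = H' i) :
    T.queriedRows H = T.queriedRows H' ∧ T.eval H = T.eval H' := by
  induction T with
  | output a => simp [queriedRows, eval]
  | query i next ih =>
    have hi : H i = H' i := h i (Finset.mem_insert_self _ _)
    have := ih (H i) (fun k hk => h k (Finset.mem_insert_of_mem hk))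
    simp only [queriedRows, eval]
    rw [← hi, this.1, this.2]
    simp

theorem queriedRows_eval_update (T : QueryTree n d) (H : Dataset n d) (i : Fin n)
    (r r' : Fin d → Bool) (h : i ∉ T.queriedRows (Function.update H i r)) :
    i ∉ T.queriedRows (Function.update H i r') ∧
      T.eval (Function.update H i r) = T.eval (Function.update H i r') := by
  have := T.queriedRows_eval_congr (H := Function.update H i r) (H' := Function.update H i r')
    (fun k hk => by
      have hki : k ≠ i := fun e => h (e ▸ hk)
      simp [Function.update_of_ne hki])
  exact ⟨this.1 ▸ h, this.2⟩

end QueryTree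

theorem encode_update (z D : Dataset n d) (i : Fin n) (r : Fin d → Bool) :
    encode z (Function.update D i r)
      = Function.update (encode z D) i (fun j => xor (z i j) (r j)) := by
  funext k j
  by_cases h : k = i
  · subst h; simp [encode]
  · simp [encode, Function.update_of_ne h]

open Classical in
/-- For a fixed encoded dataset, only the queried rows contribute to the total score, and each
of them contributes at most `τ` unless its score is exceptional. -/
theorem sum_rowScore_le (T : QueryTree n d) {q : ℕ} (hq : ∀ H, T.rowQueries H ≤ q)
    {p : Fin d → ℝ} {γ : ℝ} (hγ : 0 < γ) (h0 : ∀ j, γ ≤ p j) (h1 : ∀ j, p j ≤ 1 - γ)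
    (b : (Fin d → ℝ) → Fin d → ℝ) (hb : ∀ a j, |b a j| ≤ 1) {τ : ℝ} (hτ : 0 ≤ τ)
    (z : Dataset n d) :
    ∑ D : Dataset n d, datasetWeight p D *
        ((∑ i, rowScore p (b (T.eval (encode z D))) (D i)) - d / γ *
          ∑ i, if τ < rowScore p (b (T.eval (encode z D))) (D i) then (1 : ℝ) else 0)
      ≤ q * τ := by
  have hw : ∀ D : Dataset n d, 0 ≤ datasetWeight p D :=
    datasetWeight_nonneg (fun j => hγ.le.trans (h0 j)) (fun j => (h1 j).trans (by linarith))
  set S : Dataset n d → Fin n → ℝ := fun D i => rowScore p (b (T.eval (encode z D))) (D i)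
    with hS
  have hS_le : ∀ D i, S D i ≤ d / γ := fun D i =>
    (le_abs_self _).trans (abs_rowScore_le hγ h0 h1 (hb _) _)
  have hunq : ∀ i, ∑ D : Dataset n d, datasetWeight p D *
      (if i ∈ T.queriedRows (encode z D) then 0 else S D i) = 0 := by
    intro i
    let r₀ : Fin d → Bool := fun _ => false
    -- Off the event that row `i` is queried, row `i` of the dataset may be overwritten by a default
    -- in both the event and the output. Only the score then sees `D i`, which can be resampled as a
    -- fresh row.
    let F : Dataset n d → (Fin d → Bool) → ℝ := fun D r =>
      if i ∈ T.queriedRows (encode z D) then 0 else rowScore p (b (T.eval (encode z D))) r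
    have hF : ∀ D : Dataset n d, (if i ∈ T.queriedRows (encode z D) then 0 else S D i)
        = F (Function.update D i r₀) (D i) := by
      intro D
      have key := fun r r' => T.queriedRows_eval_update (encode z D) i r r'
      have hD : encode z D = Function.update (encode z D) i (encode z D i) := by simp
      simp only [F, encode_update, hS]
      by_cases hi : i ∈ T.queriedRows (encode z D)
      · rw [if_pos hi, if_pos]
        by_contra hc
        have := (key _ (encode z D i) hc).1
        rw [← hD] at this
        exact this hi
      · rw [if_neg hi]
        have hi' := hi
        rw [hD] at hi'
        have := key _ (fun j => xor (z i j) (r₀ j)) hi'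
        rw [← hD] at this
        rw [if_neg this.1, this.2]
    simp only [hF]
    rw [sum_datasetWeight_mul_resample]
    refine Finset.sum_eq_zero fun D _ => ?_
    simp only [F]
    split_ifs
    · simp
    · rw [sum_rowWeight_mul_rowScore (fun j => (hγ.trans_le (h0 j)).ne')
        (fun j => (lt_of_le_of_lt (h1 j) (by linarith)).ne), mul_zero]
  have hunq' : ∑ D : Dataset n d, datasetWeight p D *
      ∑ i, (if i ∈ T.queriedRows (encode z D) then 0 else S D i) = 0 := by
    simp only [Finset.mul_sum]
    rw [Finset.sum_comm]
    exact Finset.sum_eq_zero fun i _ => hunq i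
  have hpt : ∀ D : Dataset n d, (∑ i, S D i) - d / γ * (∑ i, if τ < S D i then (1 : ℝ) else 0)
      ≤ q * τ + ∑ i, (if i ∈ T.queriedRows (encode z D) then 0 else S D i) := by
    intro D
    -- The penalty `d / γ` is the largest possible score, so it cancels an exceptional queried row
    -- completely; for an unqueried row it is simply dropped.
    have hterm : ∀ i, S D i - d / γ * (if τ < S D i then (1 : ℝ) else 0)
        ≤ (if i ∈ T.queriedRows (encode z D) then τ else 0)
          + (if i ∈ T.queriedRows (encode z D) then 0 else S D i) := by
      intro i
      have := hS_le D i
      have hdγ : 0 ≤ d / γ := by positivity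
      split_ifs <;> linarith
    have hcard : (∑ i, if i ∈ T.queriedRows (encode z D) then τ else 0) ≤ q * τ := by
      rw [← Finset.sum_filter, Finset.sum_const, nsmul_eq_mul]
      refine mul_le_mul_of_nonneg_right ?_ hτ
      have := (T.card_queriedRows_le (encode z D)).trans (hq _)
      simpa using this
    rw [Finset.mul_sum, ← Finset.sum_sub_distrib]
    refine (Finset.sum_le_sum fun i _ => hterm i).trans ?_
    rw [Finset.sum_add_distrib]
    linarith
  calc _ ≤ ∑ D : Dataset n d, datasetWeight p D *
        (q * τ + ∑ i, (if i ∈ T.queriedRows (encode z D) then 0 else S D i)) :=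
        Finset.sum_le_sum fun D _ => mul_le_mul_of_nonneg_left (hpt D) (hw D)
    _ = q * τ := by
        simp only [mul_add]
        rw [Finset.sum_add_distrib, hunq', ← Finset.sum_mul, sum_datasetWeight]
        ring

/-! ### The fingerprinting identity, via the divergence theorem -/

theorem hasFDerivAt_prod_of_logDeriv {ι E : Type*} [NormedAddCommGroup E] [NormedSpace ℝ E]
    (s : Finset ι) {f : ι → E → ℝ} {L : ι → E →L[ℝ] ℝ} {x : E}
    (h : ∀ i ∈ s, HasFDerivAt (f i) (f i x • L i) x) :
    HasFDerivAt (fun y => ∏ i ∈ s, f i y) ((∏ i ∈ s, f i x) • ∑ i ∈ s, L i) x := by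
  classical
  refine (HasFDerivAt.finsetProd h).congr_fderiv ?_
  rw [Finset.smul_sum]
  refine Finset.sum_congr rfl fun i hi => ?_
  rw [smul_smul, Finset.prod_erase_mul _ _ hi]

theorem hasFDerivAt_bitWeight {p : Fin d → ℝ} {j : Fin d} (h0 : p j ≠ 0) (h1 : p j ≠ 1)
    (b : Bool) :
    HasFDerivAt (fun p : Fin d → ℝ => bitWeight (p j) b)
      (bitWeight (p j) b • bitScore (p j) b •
        ContinuousLinearMap.proj (R := ℝ) (φ := fun _ : Fin d => ℝ) j) p := by
  have hp : HasFDerivAt (fun p : Fin d → ℝ => p j)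
      (ContinuousLinearMap.proj (R := ℝ) (φ := fun _ : Fin d => ℝ) j) p :=
    (ContinuousLinearMap.proj (R := ℝ) (φ := fun _ : Fin d => ℝ) j).hasFDerivAt
  rw [smul_smul, bitWeight_mul_bitScore h0 h1]
  cases b
  · refine (hp.const_sub 1).congr_fderiv ?_
    ext
    simp
  · simpa [bitWeight] using hp

theorem hasFDerivAt_datasetWeight {p : Fin d → ℝ} (h0 : ∀ j, p j ≠ 0) (h1 : ∀ j, p j ≠ 1)
    (D : Dataset n d) :
    HasFDerivAt (fun p => datasetWeight p D)
      (datasetWeight p D • ∑ i, ∑ j, bitScore (p j) (D i j) •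
        ContinuousLinearMap.proj (R := ℝ) (φ := fun _ : Fin d => ℝ) j) p :=
  hasFDerivAt_prod_of_logDeriv _ fun i _ => hasFDerivAt_prod_of_logDeriv _ fun j _ =>
    hasFDerivAt_bitWeight (h0 j) (h1 j) (D i j)

theorem continuous_datasetWeight (D : Dataset n d) :
    Continuous fun p : Fin d → ℝ => datasetWeight p D := by
  refine continuous_finsetProd _ fun i _ => continuous_finsetProd _ fun j _ => ?_
  unfold bitWeight
  split_ifs <;> fun_prop

theorem continuousOn_bitScore {s : Set (Fin d → ℝ)} (j : Fin d) (h0 : ∀ p ∈ s, p j ≠ 0)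
    (h1 : ∀ p ∈ s, p j ≠ 1) (b : Bool) :
    ContinuousOn (fun p : Fin d → ℝ => bitScore (p j) b) s := by
  unfold bitScore
  split_ifs
  · exact continuousOn_const.div (by fun_prop) h0
  · exact (continuousOn_const.div (by fun_prop) fun p hp => sub_ne_zero.2 (h1 p hp).symm).neg

/-- If the answers `h D` track the one-way marginals of `D`, then for some choice of the column
means they correlate with the rows of a random dataset. -/
theorem le_of_sum_rowScore_le {m : ℕ} (hn : 1 ≤ n) (h : Dataset n (m + 1) → Fin (m + 1) → ℝ)
    (hlow : ∀ D j, h D j ≤ -(1 / 3) + 8 * oneWayMarginal D j)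
    (hhigh : ∀ D j, 1 / 3 - 8 * (1 - oneWayMarginal D j) ≤ h D j) {C : ℝ}
    (hC : ∀ p : Fin (m + 1) → ℝ, (∀ j, 1 / 48 ≤ p j) → (∀ j, p j ≤ 1 - 1 / 48) →
      ∑ D : Dataset n (m + 1), datasetWeight p D * ∑ i, rowScore p (h D) (D i) ≤ C) :
    ((m + 1 : ℕ) : ℝ) / 3 ≤ C := by
  -- At `p j = 1 / 48` the bound `-(1 / 3) + 8 * p j` equals `-1 / 6`, and at the opposite face the
  -- lower bound is `1 / 6`. Each pair of faces thus gives flux at least `1 / 3` times the face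
  -- volume; the sides have length `23 / 24`.
  set a : Fin (m + 1) → ℝ := fun _ => 1 / 48 with ha
  set b : Fin (m + 1) → ℝ := fun _ => 1 - 1 / 48 with hb
  have hab : a ≤ b := fun j => by simp only [ha, hb]; norm_num
  let f : Fin (m + 1) → (Fin (m + 1) → ℝ) → ℝ := fun j p =>
    ∑ D : Dataset n (m + 1), datasetWeight p D * h D j
  let f' : Fin (m + 1) → (Fin (m + 1) → ℝ) → (Fin (m + 1) → ℝ) →L[ℝ] ℝ := fun j p =>
    ∑ D : Dataset n (m + 1), h D j • (datasetWeight p D • ∑ i, ∑ k, bitScore (p k) (D i k) •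
        ContinuousLinearMap.proj (R := ℝ) (φ := fun _ : Fin (m + 1) => ℝ) k)
  have hfc : ∀ j, Continuous (f j) := fun j =>
    continuous_finsetSum _ fun D _ => (continuous_datasetWeight D).mul continuous_const
  have hdiv : ∀ p, ∑ j, f' j p (Pi.single j 1)
      = ∑ D : Dataset n (m + 1), datasetWeight p D * ∑ i, rowScore p (h D) (D i) := by
    intro p
    simp only [f', rowScore, sum_apply, smul_apply,
      ContinuousLinearMap.proj_apply, smul_eq_mul]
    rw [Finset.sum_comm]
    refine Finset.sum_congr rfl fun D _ => ?_
    rw [Finset.sum_comm (s := (Finset.univ : Finset (Fin n))), Finset.mul_sum]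
    refine Finset.sum_congr rfl fun j _ => ?_
    rw [mul_left_comm, ← Finset.mul_sum]
    congr 2
    refine Finset.sum_congr rfl fun i _ => ?_
    rw [Finset.sum_eq_single j]
    · simp
    · intro k _ hk
      simp [hk]
    · simp
  have hbox : ∀ p ∈ Set.Icc a b, ∀ j, p j ≠ 0 ∧ p j ≠ 1 := fun p hp j => by
    have h1 := hp.1 j
    have h2 := hp.2 j
    simp only [ha, hb] at h1 h2
    constructor <;> intro h3 <;> linarith
  have hint : IntegrableOn (fun p => ∑ j, f' j p (Pi.single j 1)) (Set.Icc a b) := by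
    simp only [hdiv]
    refine ContinuousOn.integrableOn_compact isCompact_Icc ?_
    refine continuousOn_finsetSum _ fun D _ => (continuous_datasetWeight D).continuousOn.mul ?_
    refine continuousOn_finsetSum _ fun i _ => continuousOn_finsetSum _ fun j _ => ?_
    exact continuousOn_const.mul (continuousOn_bitScore j (fun p hp => (hbox p hp j).1)
      (fun p hp => (hbox p hp j).2) _)
  -- The divergence of `f` is the expected total score by `hdiv`. This identity replaces the
  -- one-column fingerprinting lemma and treats all columns at once.
  have key := integral_divergence_of_hasFDerivAt_off_countable' a b hab f f' ∅
    Set.countable_empty (fun j => (hfc j).continuousOn)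
    (fun p hp j => by
      have hp' : p ∈ Set.Icc a b :=
        ⟨fun k => (hp.1 k trivial).1.le, fun k => (hp.1 k trivial).2.le⟩
      refine HasFDerivAt.fun_sum fun D _ => ?_
      exact (hasFDerivAt_datasetWeight (fun k => (hbox p hp' k).1)
        (fun k => (hbox p hp' k).2) D).mul_const (h D j)) hint
  have hupper : ∫ p in Set.Icc a b, ∑ j, f' j p (Pi.single j 1) ≤ C * (23 / 24) ^ (m + 1) := by
    calc _ ≤ ∫ _p in Set.Icc a b, C := by
          refine setIntegral_mono_on hint (integrableOn_const (by
            exact isCompact_Icc.measure_lt_top.ne)) measurableSet_Icc fun p hp => ?_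
          rw [hdiv]
          exact hC p hp.1 hp.2
      _ = C * (23 / 24) ^ (m + 1) := by
          rw [setIntegral_const, smul_eq_mul, mul_comm, Measure.real, Real.volume_Icc_pi_toReal hab]
          simp only [ha, hb, Finset.prod_const, Finset.card_univ, Fintype.card_fin]
          norm_num
  have hmean : ∀ (p : Fin (m + 1) → ℝ) (j : Fin (m + 1)) (x y : ℝ),
      ∑ D : Dataset n (m + 1), datasetWeight p D * (x + y * oneWayMarginal D j)
        = x + y * p j := by
    intro p j x y
    rw [← sum_datasetWeight_mul_oneWayMarginal hn p j, Finset.mul_sum]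
    conv_rhs => rw [← mul_one x, ← sum_datasetWeight (n := n) p, Finset.mul_sum]
    rw [← Finset.sum_add_distrib]
    exact Finset.sum_congr rfl fun D _ => by ring
  have hw : ∀ p : Fin (m + 1) → ℝ, (∀ j, 1 / 48 ≤ p j) → (∀ j, p j ≤ 1 - 1 / 48) →
      ∀ D : Dataset n (m + 1), 0 ≤ datasetWeight p D := fun p h0 h1 =>
    datasetWeight_nonneg (fun j => le_trans (by norm_num) (h0 j))
      (fun j => (h1 j).trans (by norm_num))
  have hf_low : ∀ p : Fin (m + 1) → ℝ, (∀ j, 1 / 48 ≤ p j) → (∀ j, p j ≤ 1 - 1 / 48) →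
      ∀ j, f j p ≤ -(1 / 3) + 8 * p j := by
    intro p h0 h1 j
    rw [← hmean]
    exact Finset.sum_le_sum fun D _ => mul_le_mul_of_nonneg_left (hlow D j) (hw p h0 h1 D)
  have hf_high : ∀ p : Fin (m + 1) → ℝ, (∀ j, 1 / 48 ≤ p j) → (∀ j, p j ≤ 1 - 1 / 48) →
      ∀ j, 1 / 3 - 8 + 8 * p j ≤ f j p := by
    intro p h0 h1 j
    rw [← hmean]
    refine Finset.sum_le_sum fun D _ => mul_le_mul_of_nonneg_left ?_ (hw p h0 h1 D)
    linarith [hhigh D j]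
  have hins : ∀ (i : Fin (m + 1)) (t : ℝ) (x : Fin m → ℝ), 1 / 48 ≤ t → t ≤ 1 - 1 / 48 →
      x ∈ Set.Icc (a ∘ i.succAbove) (b ∘ i.succAbove) →
      (∀ j, 1 / 48 ≤ (i.insertNth t x : Fin (m + 1) → ℝ) j) ∧
        ∀ j, (i.insertNth t x : Fin (m + 1) → ℝ) j ≤ 1 - 1 / 48 := by
    intro i t x ht0 ht1 hx
    constructor
    · intro j
      refine Fin.succAboveCases i ?_ (fun k => ?_) j
      · simpa using ht0
      · simpa [ha] using hx.1 k
    · intro j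
      refine Fin.succAboveCases i ?_ (fun k => ?_) j
      · simpa using ht1
      · simpa [hb] using hx.2 k
  have hface : ∀ i : Fin (m + 1), 1 / 3 * (23 / 24 : ℝ) ^ m ≤
      (∫ x in Set.Icc (a ∘ i.succAbove) (b ∘ i.succAbove), f i (i.insertNth (b i) x)) -
        ∫ x in Set.Icc (a ∘ i.succAbove) (b ∘ i.succAbove), f i (i.insertNth (a i) x) := by
    intro i
    have hI : ∀ t : ℝ, IntegrableOn (fun x => f i (i.insertNth t x))
        (Set.Icc (a ∘ i.succAbove) (b ∘ i.succAbove)) := fun t =>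
      (((hfc i).comp (by fun_prop)).continuousOn).integrableOn_compact isCompact_Icc
    rw [← integral_sub (hI _) (hI _)]
    calc 1 / 3 * (23 / 24 : ℝ) ^ m
        = ∫ _x in Set.Icc (a ∘ i.succAbove) (b ∘ i.succAbove), (1 / 3 : ℝ) := by
          rw [setIntegral_const, smul_eq_mul, mul_comm, Measure.real,
            Real.volume_Icc_pi_toReal (show a ∘ i.succAbove ≤ b ∘ i.succAbove from
              fun k => hab (i.succAbove k))]
          simp only [ha, hb, Function.comp, Finset.prod_const, Finset.card_univ, Fintype.card_fin]
          norm_num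
      _ ≤ _ := by
          refine setIntegral_mono_on (integrableOn_const (by
            exact isCompact_Icc.measure_lt_top.ne)) ((hI _).sub (hI _)) measurableSet_Icc
            fun x hx => ?_
          obtain ⟨hu0, hu1⟩ := hins i (b i) x (hab i) le_rfl hx
          obtain ⟨hl0, hl1⟩ := hins i (a i) x le_rfl (hab i) hx
          have h1 := hf_high _ hu0 hu1 i
          have h2 := hf_low _ hl0 hl1 i
          simp only [Fin.insertNth_apply_same] at h1 h2
          simp only [ha, hb] at h1 h2 ⊢
          linarith
  have hlower : ((m + 1 : ℕ) : ℝ) * (1 / 3 * (23 / 24 : ℝ) ^ m) ≤ C * (23 / 24) ^ (m + 1) := by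
    refine le_trans ?_ (key ▸ hupper)
    refine le_trans (le_of_eq ?_) (Finset.sum_le_sum fun i _ => hface i)
    simp
  have hpos : (0 : ℝ) < (23 / 24) ^ m := by positivity
  have h1 : ((m + 1 : ℕ) : ℝ) / 3 ≤ C * (23 / 24) := by
    refine le_of_mul_le_mul_right ?_ hpos
    calc _ = ((m + 1 : ℕ) : ℝ) * (1 / 3 * (23 / 24 : ℝ) ^ m) := by ring
      _ ≤ _ := hlower
      _ = _ := by ring
  have h2 : (0 : ℝ) ≤ ((m + 1 : ℕ) : ℝ) / 3 := by positivity
  linarith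

/-! ### Averaging over the coins and the oracle -/

theorem encode_encode (D H : Dataset n d) : encode (encode H D) D = H := by
  funext i j
  simp [encode]

namespace Algorithm

/-- The oracle is independent of the dataset given the encoded dataset, so one may first draw
the encoded dataset uniformly. -/
theorem integral_outputLaw (A : Algorithm.{u} n d) (D : Dataset n d) {F : (Fin d → ℝ) → ℝ}
    (hF : Measurable F) {B : ℝ} (hB : ∀ a, |F a| ≤ B) :
    ∫ a, F a ∂A.outputLaw D = ∑ z : Dataset n d, (Fintype.card (Dataset n d) : ℝ)⁻¹ *
      ∫ ω, F ((A.run ω z).eval (encode z D)) ∂A.law := by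
  have hint : ∀ z H, Integrable (fun ω => F ((A.run ω z).eval H)) A.law := fun z H =>
    Integrable.of_bound (hF.comp (A.measurable_eval z H)).aestronglyMeasurable B
      (ae_of_all _ fun _ => hB _)
  rw [outputLaw, integral_map (A.measurable_result D).aemeasurable hF.aestronglyMeasurable,
    integral_prod (fun x => F (A.result D x)) (Integrable.of_bound
      (hF.comp (A.measurable_result D)).aestronglyMeasurable B (ae_of_all _ fun _ => hB _))]
  simp only [PMF.integral_eq_sum, PMF.uniformOfFintype_apply, result, smul_eq_mul]
  rw [integral_finsetSum _ fun H _ => (hint _ _).const_mul _]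
  simp only [integral_const_mul]
  refine Finset.sum_nbij' (fun H => encode H D) (fun z => encode z D) (by simp) (by simp)
    (by simp [encode_encode]) (by simp [encode_encode]) ?_
  intro H _
  simp [encode_encode]

/-- Since `z` is uniform whatever `D` is, the sum over datasets can be moved inside the averages
over coins and `z`. A bound for each deterministic query tree therefore suffices. -/
theorem sum_integral_outputLaw_le (A : Algorithm.{u} n d) (w : Dataset n d → ℝ)
    {F : Dataset n d → (Fin d → ℝ) → ℝ} (hF : ∀ D, Measurable (F D)) {B : ℝ}
    (hB : ∀ D a, |F D a| ≤ B) {c : ℝ}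
    (h : ∀ ω z, ∑ D, w D * F D ((A.run ω z).eval (encode z D)) ≤ c) :
    ∑ D, w D * ∫ a, F D a ∂A.outputLaw D ≤ c := by
  have hint : ∀ z D, Integrable (fun ω => w D * F D ((A.run ω z).eval (encode z D))) A.law :=
    fun z D => (Integrable.of_bound
      ((hF D).comp (A.measurable_eval z _)).aestronglyMeasurable B
      (ae_of_all _ fun _ => hB _ _)).const_mul _
  have hcard : (0 : ℝ) < Fintype.card (Dataset n d) := by exact_mod_cast Fintype.card_pos
  calc ∑ D, w D * ∫ a, F D a ∂A.outputLaw D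
      = ∑ z : Dataset n d, (Fintype.card (Dataset n d) : ℝ)⁻¹ *
          ∫ ω, ∑ D, w D * F D ((A.run ω z).eval (encode z D)) ∂A.law := by
        simp only [integral_outputLaw A _ (hF _) (hB _), Finset.mul_sum]
        rw [Finset.sum_comm]
        refine Finset.sum_congr rfl fun z _ => ?_
        rw [integral_finsetSum _ fun D _ => hint z D, Finset.mul_sum]
        refine Finset.sum_congr rfl fun D _ => ?_
        rw [integral_const_mul]
        ring
    _ ≤ ∑ _z : Dataset n d, (Fintype.card (Dataset n d) : ℝ)⁻¹ * c := by
        refine Finset.sum_le_sum fun z _ => mul_le_mul_of_nonneg_left ?_ (by positivity)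
        calc _ ≤ ∫ _ω, c ∂A.law := integral_mono
              (integrable_finsetSum _ fun D _ => hint z D) (integrable_const _) fun ω => h ω z
          _ = c := by simp
    _ = c := by
        rw [Finset.sum_const, nsmul_eq_mul, Finset.card_univ]
        field_simp

end Algorithm

/-! ### Rounding the output to signs -/

/-- The output vector rounded to signs at the threshold `1 / 2`. -/
noncomputable def roundSign (a : Fin d → ℝ) (j : Fin d) : ℝ := if 1 / 2 ≤ a j then 1 else -1

theorem measurable_roundSign (j : Fin d) :
    Measurable fun a : Fin d → ℝ => roundSign a j :=
  Measurable.ite (measurableSet_le measurable_const (measurable_pi_apply j))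
    measurable_const measurable_const

theorem abs_roundSign_le (a : Fin d → ℝ) (j : Fin d) : |roundSign a j| ≤ 1 := by
  unfold roundSign
  split_ifs <;> simp

theorem integrable_roundSign (μ : Measure (Fin d → ℝ)) [IsFiniteMeasure μ] (j : Fin d) :
    Integrable (fun a => roundSign a j) μ :=
  Integrable.of_bound (measurable_roundSign j).aestronglyMeasurable 1
    (ae_of_all _ fun a => abs_roundSign_le a j)

theorem measurable_rowScore_roundSign (p : Fin d → ℝ) (r : Fin d → Bool) :
    Measurable fun a : Fin d → ℝ => rowScore p (roundSign a) r :=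
  Finset.measurable_sum _ fun j _ => (measurable_roundSign j).mul_const _

theorem measurableSet_rowScore_gt (p : Fin d → ℝ) (r : Fin d → Bool) (τ : ℝ) :
    MeasurableSet {a : Fin d → ℝ | τ < rowScore p (roundSign a) r} :=
  measurableSet_lt measurable_const (measurable_rowScore_roundSign p r)

theorem oneWayMarginal_nonneg (D : Dataset n d) (j : Fin d) : 0 ≤ oneWayMarginal D j :=
  div_nonneg (Finset.sum_nonneg fun i _ => by split_ifs <;> norm_num) (Nat.cast_nonneg _)

theorem oneWayMarginal_le_one (D : Dataset n d) (j : Fin d) : oneWayMarginal D j ≤ 1 := by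
  refine div_le_one_of_le₀ ?_ (Nat.cast_nonneg _)
  refine (Finset.sum_le_sum (g := fun _ => (1 : ℝ)) fun i _ => ?_).trans (by simp)
  split_ifs <;> norm_num

theorem measurableSet_accurate (D : Dataset n d) (α : ℝ) :
    MeasurableSet {a : Fin d → ℝ | ∀ j, |oneWayMarginal D j - a j| ≤ α} := by
  rw [Set.ofPred_forall]
  refine MeasurableSet.iInter fun j => measurableSet_le ?_ measurable_const
  fun_prop

theorem integral_le_of_le_on {Ω : Type*} [MeasurableSpace Ω] {μ : Measure Ω}
    [IsProbabilityMeasure μ] {S : Set Ω} (hS : MeasurableSet S) (hμ : 2 / 3 ≤ μ.real S)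
    {f : Ω → ℝ} (hf : Integrable f μ) (h1 : ∀ x, f x ≤ 1) (h2 : ∀ x ∈ S, f x ≤ -1) :
    ∫ x, f x ∂μ ≤ -(1 / 3) := by
  have hi : Integrable (S.indicator fun _ => (2 : ℝ)) μ := (integrable_const _).indicator hS
  calc ∫ x, f x ∂μ ≤ ∫ x, (1 - S.indicator (fun _ => (2 : ℝ)) x) ∂μ := by
        refine integral_mono hf ((integrable_const _).sub hi) fun x => ?_
        by_cases hx : x ∈ S
        · simp only [Set.indicator_of_mem hx]; linarith [h2 x hx]
        · simp only [Set.indicator_of_notMem hx]; linarith [h1 x]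
    _ = 1 - μ.real S * 2 := by
        rw [integral_sub (integrable_const _) hi, integral_indicator_const _ hS]
        simp
    _ ≤ _ := by linarith

namespace Algorithm

/-- If the marginal is below `1 / 6`, an accurate answer is below `1 / 2`, so the sign is `-1` with
probability at least `2 / 3` and has mean at most `-1 / 3`. Otherwise the right side is at least
`1`. As the bound is affine in the marginal, its average over `D` depends on `p` alone, with no need
for concentration or large `n`. -/
theorem Accurate.integral_roundSign_le {A : Algorithm.{u} n d} (hA : A.Accurate (1 / 3) (1 / 3))
    (D : Dataset n d) (j : Fin d) :
    ∫ a, roundSign a j ∂A.outputLaw D ≤ -(1 / 3) + 8 * oneWayMarginal D j := by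
  have hle : ∀ a : Fin d → ℝ, roundSign a j ≤ 1 := fun a =>
    (le_abs_self _).trans (abs_roundSign_le a j)
  by_cases h : oneWayMarginal D j < 1 / 6
  · have := integral_le_of_le_on (measurableSet_accurate D (1 / 3))
      (le_trans (by norm_num) (hA D)) (integrable_roundSign _ j) hle (fun a ha => by
        have := (abs_le.1 (ha j)).1
        rw [roundSign, if_neg (by linarith)])
    linarith [oneWayMarginal_nonneg D j]
  · have := integral_mono (integrable_roundSign (A.outputLaw D) j) (integrable_const 1) hle
    simp only [integral_const, probReal_univ, smul_eq_mul, mul_one] at this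
    linarith

theorem Accurate.le_integral_roundSign {A : Algorithm.{u} n d} (hA : A.Accurate (1 / 3) (1 / 3))
    (D : Dataset n d) (j : Fin d) :
    1 / 3 - 8 * (1 - oneWayMarginal D j) ≤ ∫ a, roundSign a j ∂A.outputLaw D := by
  have hle : ∀ a : Fin d → ℝ, -roundSign a j ≤ 1 := fun a =>
    (neg_le_abs _).trans (abs_roundSign_le a j)
  by_cases h : 5 / 6 < oneWayMarginal D j
  · have := integral_le_of_le_on (measurableSet_accurate D (1 / 3))
      (le_trans (by norm_num) (hA D)) (integrable_roundSign _ j).neg hle (fun a ha => by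
        have := (abs_le.1 (ha j)).2
        simp only [Pi.neg_apply]
        rw [roundSign, if_pos (by linarith)])
    simp only [Pi.neg_apply, integral_neg] at this
    linarith [oneWayMarginal_le_one D j]
  · have := integral_mono (integrable_roundSign (A.outputLaw D) j).neg (integrable_const 1) hle
    simp only [Pi.neg_apply, integral_neg, integral_const, probReal_univ, smul_eq_mul,
      mul_one] at this
    linarith

/-! ### Combining accuracy, few queries and privacy -/

/-- An accurate algorithm with few row queries must give some row an exceptional score. -/
theorem Accurate.le_of_tail_le (hn : 1 ≤ n) {m : ℕ} {A : Algorithm.{u} n (m + 1)}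
    (hA : A.Accurate (1 / 3) (1 / 3)) {q : ℕ} (hq : ∀ ω z H, (A.run ω z).rowQueries H ≤ q)
    {τ β : ℝ} (hτ : 0 ≤ τ)
    (htail : ∀ p : Fin (m + 1) → ℝ, (∀ j, 1 / 48 ≤ p j) → (∀ j, p j ≤ 1 - 1 / 48) →
      ∀ i : Fin n, ∑ D : Dataset n (m + 1), datasetWeight p D *
        (A.outputLaw D).real {a | τ < rowScore p (roundSign a) (D i)} ≤ β) :
    ((m + 1 : ℕ) : ℝ) / 3 ≤ q * τ + ((m + 1 : ℕ) : ℝ) / (1 / 48) * (n * β) := by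
  classical
  refine le_of_sum_rowScore_le hn (fun D j => ∫ a, roundSign a j ∂A.outputLaw D)
    hA.integral_roundSign_le hA.le_integral_roundSign fun p h0 h1 => ?_
  set M : ℝ := ((m + 1 : ℕ) : ℝ) / (1 / 48) with hM
  have hM0 : 0 ≤ M := by positivity
  have hγ : (0 : ℝ) < 1 / 48 := by norm_num
  let G : Dataset n (m + 1) → (Fin (m + 1) → ℝ) → ℝ := fun D a =>
    ∑ i, rowScore p (roundSign a) (D i)
  let T : Dataset n (m + 1) → (Fin (m + 1) → ℝ) → ℝ := fun D a =>
    ∑ i, if τ < rowScore p (roundSign a) (D i) then (1 : ℝ) else 0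
  have hGm : ∀ D, Measurable (G D) := fun D =>
    Finset.measurable_sum _ fun i _ => measurable_rowScore_roundSign p (D i)
  have hTm : ∀ D, Measurable (T D) := fun D =>
    Finset.measurable_sum _ fun i _ => Measurable.ite (measurableSet_rowScore_gt p (D i) τ)
      measurable_const measurable_const
  have hGb : ∀ D a, |G D a| ≤ n * M := fun D a => by
    refine (Finset.abs_sum_le_sum_abs _ _).trans ((Finset.sum_le_sum fun i _ =>
      abs_rowScore_le hγ h0 h1 (abs_roundSign_le a) (D i)).trans_eq ?_)
    simp [hM]
  have hTb : ∀ D a, |T D a| ≤ n := fun D a => by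
    refine (Finset.abs_sum_le_sum_abs _ _).trans ((Finset.sum_le_sum
      (g := fun _ => (1 : ℝ)) fun i _ => ?_).trans_eq ?_)
    · split_ifs <;> simp
    · simp
  have hGi : ∀ D, Integrable (G D) (A.outputLaw D) := fun D =>
    Integrable.of_bound (hGm D).aestronglyMeasurable _ (ae_of_all _ (hGb D))
  have hTi : ∀ D, Integrable (T D) (A.outputLaw D) := fun D =>
    Integrable.of_bound (hTm D).aestronglyMeasurable _ (ae_of_all _ (hTb D))
  have hG : ∀ D, ∑ i, rowScore p (fun j => ∫ a, roundSign a j ∂A.outputLaw D) (D i)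
      = ∫ a, G D a ∂A.outputLaw D := by
    intro D
    have hj : ∀ i j, Integrable (fun a => roundSign a j * bitScore (p j) (D i j))
        (A.outputLaw D) := fun i j => (integrable_roundSign _ j).mul_const _
    simp only [G, rowScore]
    rw [integral_finsetSum _ fun i _ => integrable_finsetSum _ fun j _ => hj i j]
    refine Finset.sum_congr rfl fun i _ => ?_
    rw [integral_finsetSum _ fun j _ => hj i j]
    simp only [integral_mul_const]
  have hT : ∀ D, ∫ a, T D a ∂A.outputLaw D
      = ∑ i, (A.outputLaw D).real {a | τ < rowScore p (roundSign a) (D i)} := by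
    intro D
    have hind : ∀ i, (fun a : Fin (m + 1) → ℝ =>
        if τ < rowScore p (roundSign a) (D i) then (1 : ℝ) else 0)
        = {a | τ < rowScore p (roundSign a) (D i)}.indicator fun _ => (1 : ℝ) := fun i => by
      funext a
      simp [Set.indicator_apply]
    have hset := fun i => measurableSet_rowScore_gt p (D i) τ
    simp only [T]
    rw [integral_finsetSum _ fun i _ => by
      rw [hind]; exact (integrable_const _).indicator (hset i)]
    refine Finset.sum_congr rfl fun i _ => ?_
    rw [hind, integral_indicator_const _ (hset i), smul_eq_mul, mul_one]
  -- The penalized score is bounded tree by tree; the penalty is paid back on average through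
  -- `htail`, where privacy enters.
  have hmain := A.sum_integral_outputLaw_le (datasetWeight p) (F := fun D a => G D a - M * T D a)
    (fun D => (hGm D).sub ((hTm D).const_mul M)) (B := n * M + M * n)
    (fun D a => (abs_sub _ _).trans (add_le_add (hGb D a) (by
      rw [abs_mul, abs_of_nonneg hM0]
      exact mul_le_mul_of_nonneg_left (hTb D a) hM0)))
    (fun ω z => sum_rowScore_le (A.run ω z) (hq ω z) hγ h0 h1 roundSign abs_roundSign_le hτ z)
  have hsplit : ∀ D, ∫ a, (G D a - M * T D a) ∂A.outputLaw D
      = ∫ a, G D a ∂A.outputLaw D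
        - M * ∑ i, (A.outputLaw D).real {a | τ < rowScore p (roundSign a) (D i)} := fun D => by
    rw [integral_sub (hGi D) ((hTi D).const_mul M), integral_const_mul, hT]
  have hsum : ∑ D : Dataset n (m + 1), datasetWeight p D * (M *
      ∑ i, (A.outputLaw D).real {a | τ < rowScore p (roundSign a) (D i)}) ≤ M * (n * β) := by
    calc _ = M * ∑ i, ∑ D : Dataset n (m + 1), datasetWeight p D *
          (A.outputLaw D).real {a | τ < rowScore p (roundSign a) (D i)} := by
          rw [Finset.sum_comm, Finset.mul_sum]
          refine Finset.sum_congr rfl fun D _ => ?_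
          rw [mul_left_comm, Finset.mul_sum]
      _ ≤ M * ∑ _i : Fin n, β := mul_le_mul_of_nonneg_left
          (Finset.sum_le_sum fun i _ => htail p h0 h1 i) hM0
      _ = M * (n * β) := by simp
  simp only [hsplit, mul_sub, Finset.sum_sub_distrib] at hmain
  simp only [hG]
  linarith

/-- By privacy, a row has an exceptional score hardly more often than a fresh row would. -/
theorem DifferentiallyPrivate.sum_tail_le {A : Algorithm.{u} n d} {ε δ : ℝ}
    (hA : A.DifferentiallyPrivate ε δ) {p : Fin d → ℝ} {γ : ℝ} (hγ : 0 < γ)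
    (h0 : ∀ j, γ ≤ p j) (h1 : ∀ j, p j ≤ 1 - γ) {l : ℝ} (hl0 : 0 ≤ l) (hl1 : l ≤ γ) (τ : ℝ)
    (i : Fin n) :
    ∑ D : Dataset n d, datasetWeight p D *
        (A.outputLaw D).real {a | τ < rowScore p (roundSign a) (D i)}
      ≤ Real.exp ε * Real.exp (d * (l / γ) ^ 2 - l * τ) + δ := by
  classical
  have hp0 : ∀ j, 0 ≤ p j := fun j => hγ.le.trans (h0 j)
  have hp1 : ∀ j, p j ≤ 1 := fun j => (h1 j).trans (by linarith)
  have hw : ∀ D : Dataset n d, 0 ≤ datasetWeight p D := datasetWeight_nonneg hp0 hp1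
  let r₀ : Fin d → Bool := fun _ => false
  let F : Dataset n d → (Fin d → Bool) → ℝ := fun D r =>
    (A.outputLaw D).real {a | τ < rowScore p (roundSign a) r}
  have hfresh : ∀ D, ∑ r, rowWeight p r * F D r ≤ Real.exp (d * (l / γ) ^ 2 - l * τ) := by
    intro D
    have hint : ∀ r, Integrable ({a : Fin d → ℝ | τ < rowScore p (roundSign a) r}.indicator
        fun _ => rowWeight p r) (A.outputLaw D) := fun r =>
      (integrable_const _).indicator (measurableSet_rowScore_gt p r τ)
    calc ∑ r, rowWeight p r * F D r
        = ∫ a, ∑ r, ({a : Fin d → ℝ | τ < rowScore p (roundSign a) r}.indicator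
            (fun _ => rowWeight p r)) a ∂A.outputLaw D := by
          rw [integral_finsetSum _ fun r _ => hint r]
          refine Finset.sum_congr rfl fun r _ => ?_
          rw [integral_indicator_const _ (measurableSet_rowScore_gt p r τ), smul_eq_mul, mul_comm]
      _ ≤ ∫ _a, Real.exp (d * (l / γ) ^ 2 - l * τ) ∂A.outputLaw D := by
          refine integral_mono (integrable_finsetSum _ fun r _ => hint r) (integrable_const _)
            fun a => ?_
          refine le_trans (le_of_eq ?_)
            (sum_rowWeight_rowScore_gt_le hγ h0 h1 (abs_roundSign_le a) hl0 hl1 τ)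
          exact Finset.sum_congr rfl fun r _ => by simp [Set.indicator_apply]
      _ = _ := by simp
  -- Only the input changes to the neighbour without row `i`; the event still tests the original `D
  -- i`, which is now independent of the output.
  have hstep : ∀ D : Dataset n d, F D (D i)
      ≤ Real.exp ε * F (Function.update D i r₀) (D i) + δ := fun D =>
    hA D (Function.update D i r₀) ⟨i, fun k hk => by rw [Function.update_of_ne hk]⟩ _
      (measurableSet_rowScore_gt p (D i) τ)
  calc ∑ D : Dataset n d, datasetWeight p D * F D (D i)
      ≤ ∑ D : Dataset n d, datasetWeight p D *
          (Real.exp ε * F (Function.update D i r₀) (D i) + δ) :=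
        Finset.sum_le_sum fun D _ => mul_le_mul_of_nonneg_left (hstep D) (hw D)
    _ = Real.exp ε * (∑ D : Dataset n d, datasetWeight p D *
          F (Function.update D i r₀) (D i)) + δ := by
        simp only [mul_add]
        rw [Finset.sum_add_distrib, ← Finset.sum_mul, sum_datasetWeight, one_mul, Finset.mul_sum]
        simp only [mul_left_comm]
    _ ≤ Real.exp ε * Real.exp (d * (l / γ) ^ 2 - l * τ) + δ := by
        refine add_le_add_left (mul_le_mul_of_nonneg_left ?_ (Real.exp_pos _).le) _
        rw [sum_datasetWeight_mul_resample]
        calc _ ≤ ∑ D : Dataset n d, datasetWeight p D * Real.exp (d * (l / γ) ^ 2 - l * τ) :=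
              Finset.sum_le_sum fun D _ => mul_le_mul_of_nonneg_left (hfresh _) (hw D)
          _ = _ := by rw [← Finset.sum_mul, sum_datasetWeight, one_mul]

/-- Without row queries the output does not depend on the dataset, so it is not accurate. -/
theorem Accurate.exists_rowQueries_pos (hn : 1 ≤ n) {m : ℕ} {A : Algorithm.{u} n (m + 1)}
    (hA : A.Accurate (1 / 3) (1 / 3)) : ∃ ω z H, 0 < (A.run ω z).rowQueries H := by
  by_contra! hq
  -- Taking `τ` to be the worst-case score makes exceptional rows impossible, so `β = 0` needs no
  -- privacy.
  have hM : (0 : ℝ) ≤ ((m + 1 : ℕ) : ℝ) / (1 / 48) := by positivity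
  have h := hA.le_of_tail_le hn hq (β := 0) hM fun p h0 h1 i => by
    refine (Finset.sum_eq_zero fun D _ => ?_).le
    have : {a : Fin (m + 1) → ℝ | ((m + 1 : ℕ) : ℝ) / (1 / 48)
        < rowScore p (roundSign a) (D i)} = ∅ := by
      ext a
      simp only [Set.mem_ofPred_eq, Set.mem_empty_iff_false, iff_false, not_lt]
      exact (le_abs_self _).trans (abs_rowScore_le (by norm_num) h0 h1 (abs_roundSign_le a) _)
    rw [this]
    simp
  have h' : (0 : ℝ) < ((m + 1 : ℕ) : ℝ) / 3 := by positivity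
  simp only [Nat.cast_zero, zero_mul, mul_zero, add_zero] at h
  linarith

theorem le_of_accurate_of_differentiallyPrivate (hn : 1 ≤ n) (hd : 2 ≤ d)
    {A : Algorithm.{u} n d} (hA : A.Accurate (1 / 3) (1 / 3)) {ε δ : ℝ}
    (hP : A.DifferentiallyPrivate ε δ) {q : ℕ} (hq : ∀ ω z H, (A.run ω z).rowQueries H ≤ q) :
    (d : ℝ) / 3 ≤ q * (144 * Real.sqrt (d * Real.log d))
      + 48 * d * (n * (Real.exp ε / d ^ 2 + δ)) := by
  obtain ⟨m, rfl⟩ : ∃ m, d = m + 1 := ⟨d - 1, by omega⟩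
  set x : ℝ := ((m + 1 : ℕ) : ℝ) with hx
  have hx2 : (2 : ℝ) ≤ x := by rw [hx]; exact_mod_cast hd
  have hx0 : 0 < x := by linarith
  have hlog : 0 < Real.log x := Real.log_pos (by linarith)
  have hlogle : Real.log x ≤ x := (Real.log_le_sub_one_of_pos hx0).trans (by linarith)
  set y : ℝ := Real.sqrt (Real.log x / x) with hy
  have hy0 : 0 ≤ y := Real.sqrt_nonneg _
  have hy1 : y ≤ 1 := Real.sqrt_le_one.2 ((div_le_one hx0).2 hlogle)
  have hy2 : x * y ^ 2 = Real.log x := by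
    rw [hy, Real.sq_sqrt (by positivity)]
    field_simp
  have hyX : Real.sqrt (x * Real.log x) = x * y := by
    rw [Real.sqrt_eq_iff_mul_self_eq (by positivity) (by positivity), ← hy2]
    ring
  -- With `l = y / 48` and `τ = 144 * (x * y)` the Chernoff exponent is `x * y ^ 2 - 3 * (x * y ^ 2)
  -- = -2 * log x`. The bound `y ≤ 1` ensures `l ≤ γ`.
  have hexp : Real.exp (x * (1 / 48 * y / (1 / 48)) ^ 2 - 1 / 48 * y * (144 * (x * y)))
      = 1 / x ^ 2 := by
    have : x * (1 / 48 * y / (1 / 48)) ^ 2 - 1 / 48 * y * (144 * (x * y))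
        = -(2 * Real.log x) := by
      rw [← hy2]; ring
    rw [this, Real.exp_neg, ← Nat.cast_ofNat (n := 2), Real.exp_nat_mul, Real.exp_log hx0, one_div]
  have h := hA.le_of_tail_le hn hq (τ := 144 * (x * y)) (by positivity) fun p h0 h1 i =>
    hP.sum_tail_le (by norm_num) h0 h1 (l := 1 / 48 * y) (by positivity) (by linarith)
      (144 * (x * y)) i
  rw [← hx, hexp] at h
  rw [hyX]
  calc x / 3 ≤ _ := h
    _ = _ := by ring

end Algorithm

end RandomOracleMarginals

/-! ### Choice of constants -/

theorem theorem4p2 (ε₀ K : ℝ) :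
    ∃ η c : ℝ, 0 < η ∧ 0 < c ∧
      ∀ (n d s : ℕ), 1 ≤ n → 2 ≤ d → (n : ℝ) ≤ K * d →
        ∀ (ε δ : ℝ), ε ≤ ε₀ → δ * s ≤ η →
          ∀ A : RandomOracleMarginals.Algorithm.{u} n d,
            A.AttributeQueriesLE s →
            A.Accurate (1 / 3) (1 / 3) →
            A.DifferentiallyPrivate ε δ →
            c * (d * Real.sqrt (d / Real.log d)) ≤ s := by
  set L : ℝ := max K 1 with hL
  have hL1 : 1 ≤ L := le_max_right _ _
  have hE : 0 < Real.exp ε₀ := Real.exp_pos _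
  set B : ℝ := 6 * (144 + 48 * L * Real.exp ε₀) with hB
  have hB0 : 0 < B := by positivity
  -- The value `1 / (288 * L)` makes the `δ` term at most `d / 6`, half of the `d / 3` available;
  -- the remaining `d / 6` explains the factor `6` in `B`.
  refine ⟨1 / (288 * L), 1 / B, by positivity, by positivity, ?_⟩
  intro n d s hn hd hnK ε δ hε hδ A hs hacc hdp
  have hq : ∀ ω z H, (A.run ω z).rowQueries H ≤ s / d := fun ω z H =>
    (Nat.le_div_iff_mul_le (by omega)).2 (hs ω z H)
  -- At least one query is needed for two purposes: `d ≤ s` turns the bound on `δ * s` into one on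
  -- `δ * d`, and `1 ≤ q * X` absorbs the constant `48 * L * exp ε₀`.
  have hq1 : 1 ≤ s / d := by
    obtain ⟨m, rfl⟩ : ∃ m, d = m + 1 := ⟨d - 1, by omega⟩
    obtain ⟨ω, z, H, h⟩ := hacc.exists_rowQueries_pos hn
    exact h.trans_le (hq ω z H)
  have main := RandomOracleMarginals.Algorithm.le_of_accurate_of_differentiallyPrivate hn hd
    hacc hdp hq
  have hqs : ((s / d : ℕ) : ℝ) * d ≤ s := by exact_mod_cast Nat.div_mul_le_self s d
  have hq1' : (1 : ℝ) ≤ ((s / d : ℕ) : ℝ) := by exact_mod_cast hq1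
  set q : ℝ := ((s / d : ℕ) : ℝ)
  have hd2 : (2 : ℝ) ≤ d := by exact_mod_cast hd
  have hd0 : (0 : ℝ) < d := by linarith
  have hn0 : (0 : ℝ) ≤ n := by positivity
  have hnL : (n : ℝ) ≤ L * d := hnK.trans (mul_le_mul_of_nonneg_right (le_max_left _ _) hd0.le)
  have hds : (d : ℝ) ≤ s := by nlinarith
  have hδd : δ * d ≤ 1 / (288 * L) := by
    -- For negative `δ` the product `δ * d` cannot be compared with `δ * s` through `d ≤ s`, but it
    -- is nonpositive.
    rcases le_total δ 0 with h | h
    · exact (mul_nonpos_of_nonpos_of_nonneg h hd0.le).trans (by positivity)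
    · exact (mul_le_mul_of_nonneg_left hds h).trans hδ
  set X : ℝ := Real.sqrt (d * Real.log d) with hX
  have hlog : 1 / 2 ≤ Real.log d :=
    le_trans (by linarith [Real.log_two_gt_d9]) (Real.log_le_log (by norm_num) hd2)
  have hX1 : 1 ≤ X := Real.one_le_sqrt.2 (by nlinarith)
  have h1 : 48 * d * (n * (Real.exp ε / d ^ 2)) ≤ 48 * L * Real.exp ε₀ := by
    calc 48 * d * (n * (Real.exp ε / d ^ 2))
        ≤ 48 * d * ((L * d) * (Real.exp ε₀ / d ^ 2)) := by
          gcongr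
      _ = 48 * L * Real.exp ε₀ := by field_simp
  have h2 : 48 * d * (n * δ) ≤ d / 6 := by
    calc 48 * d * (n * δ) = 48 * n * (δ * d) := by ring
      _ ≤ 48 * n * (1 / (288 * L)) := mul_le_mul_of_nonneg_left hδd (by positivity)
      _ ≤ 48 * (L * d) * (1 / (288 * L)) := by gcongr
      _ = d / 6 := by field_simp; norm_num
  have h3 : (d : ℝ) ≤ B * (q * X) := by
    have hqX : 1 ≤ q * X := one_le_mul_of_one_le_of_one_le hq1' hX1
    have := mul_le_mul_of_nonneg_left hqX (by positivity : 0 ≤ 48 * L * Real.exp ε₀)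
    have hsplit : 48 * (d : ℝ) * (n * (Real.exp ε / d ^ 2 + δ))
        = 48 * d * (n * (Real.exp ε / d ^ 2)) + 48 * d * (n * δ) := by ring
    rw [hsplit] at main
    rw [hB]
    linarith
  have hXY : X * Real.sqrt (d / Real.log d) = d := by
    rw [hX, ← Real.sqrt_mul (by positivity), Real.sqrt_eq_iff_mul_self_eq (by positivity) hd0.le]
    field_simp
  have h4 : (d : ℝ) * Real.sqrt (d / Real.log d) ≤ B * s := by
    refine le_of_mul_le_mul_left ?_ (zero_lt_one.trans_le hX1)
    calc X * (d * Real.sqrt (d / Real.log d)) = d * d := by rw [mul_left_comm, hXY]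
      _ ≤ B * (q * X) * d := mul_le_mul_of_nonneg_right h3 hd0.le
      _ = X * (B * (q * d)) := by ring
      _ ≤ X * (B * s) := by gcongr
  rw [one_div, inv_mul_le_iff₀ hB0]
  exact h4
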